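/- Let $X$ be a real Hausdorff locally convex space all of whose bounded subsets are metrizable (in the subspace topology), and let $X^*$ be its continuous dual. Definitions. A sequence $(x_n)$ in $X$ is weak Cauchy if $(u(x_n))$ converges for every $u\in X^*$. A bounded sequence $(x_n)$ is an $l^1$-sequence if there are a continuous seminorm $\rho$ on $X$ and $\delta>0$ with $\delta\sum_{i=1}^n|c_i|\le\rho\big(\sum_{i=1}^n c_ix_i\big)$ for all $n$ and all $c_1,\dots,c_n\in\mathbb R$. A sequence $(f_n)$ of real functions on a set $K$ is independent if there are reals $a<b$ such that for all disjoint finite $P,M\subset\mathbb N$ some $t\in K$ satisfies $f_n(t)<a$ for all $n\in P$ and $f_n(t)>b$ for all $n\in M$. A bounded set $B\subseteq X$ is tame over $K\subseteq X^*$ if no sequence of elements of $B$, viewed as functions on $K$, is independent. The set $B$ is tame if it is tame over every equicontinuous weak-star compact $K\subseteq X^*$, Mackey tame if it is tame over every weak-star compact $K\subseteq X^*$, and Rosenthal if every sequence in $B$ has a weak Cauchy subsequence. Consider the following properties of $X$: $(\mathrm{Ros})$ every bounded sequence in $X$ has a weak Cauchy subsequence; $(\mathrm{mT})$ every bounded subset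 of $X$ is Mackey tame; $(\mathrm{T})$ every bounded subset of $X$ is tame; $(\mathrm{R}_1)$ $X$ contains no $l^1$-sequence; $(\overline{\mathrm{R}_1})$ there is no linear topological embedding of the Banach space $l^1$ into $X$. Then: (1) $(\mathrm{Ros})\Leftrightarrow(\mathrm{mT})\Leftrightarrow(\mathrm{T})\Leftrightarrow(\mathrm{R}_1)\Rightarrow(\overline{\mathrm{R}_1})$; (2) a bounded subset $B\subseteq X$ is Rosenthal if and only if it is tame; (3) (generalized Rosenthal dichotomy) every bounded sequence in $X$ has a weak Cauchy subsequence or a subsequence that is an $l^1$-sequence. -/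

import Mathlib

open Filter Topology

noncomputable section

namespace TameLCS

/-! ### Independence and tameness for families of real functions on a set -/

/-- A sequence of real functions on a set `X` is (combinatorially) independent, with bounds
of independence `a < b`. -/
def IsIndependentSeq {X : Type*} (f : ℕ → X → ℝ) : Prop :=
  ∃ a b : ℝ, a < b ∧ ∀ P M : Finset ℕ, Disjoint P M →
    ((⋂ n ∈ P, {x : X | f n x < a}) ∩ (⋂ n ∈ M, {x : X | b < f n x})).Nonempty

/-- A family of real functions on a set `X` is tame if it contains no independent sequence. -/
def IsTameFamily {X : Type*} (F : Set (X → ℝ)) : Prop :=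
  ¬ ∃ f : ℕ → X → ℝ, (∀ n, f n ∈ F) ∧ IsIndependentSeq f

/-! ### Notions in a real locally convex space -/

section

variable {E : Type*} [AddCommGroup E] [Module ℝ E] [TopologicalSpace E]

/-- The elements of `B ⊆ E`, viewed as real functions on the set `K` of functionals. -/
def evalFamily (B : Set E) (K : Set (WeakDual ℝ E)) : Set (K → ℝ) :=
  (fun (x : E) (φ : K) => (φ : WeakDual ℝ E) x) '' B

/-- `B` is tame over `K`, as a family of functions on `K`. -/
def IsTameOver (B : Set E) (K : Set (WeakDual ℝ E)) : Prop :=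
  IsTameFamily (evalFamily B K)

/-- `K` is an equicontinuous set of functionals on `E`. -/
def IsEquicontinuousSet (K : Set (WeakDual ℝ E)) : Prop :=
  Equicontinuous (fun (φ : K) (x : E) => (φ : WeakDual ℝ E) x)

/-- `B` is tame: it is tame over every equicontinuous weak-star compact set of functionals. -/
def IsTameSet (B : Set E) : Prop :=
  ∀ K : Set (WeakDual ℝ E), IsCompact K → IsEquicontinuousSet K → IsTameOver B K

/-- `B` is Mackey tame: it is tame over every weak-star compact set of functionals. -/
def IsMackeyTameSet (B : Set E) : Prop :=
  ∀ K : Set (WeakDual ℝ E), IsCompact K → IsTameOver B K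

/-- A sequence in `E` is bounded if its range is a bounded set. -/
def IsBoundedSeq (x : ℕ → E) : Prop :=
  Bornology.IsVonNBounded ℝ (Set.range x)

/-- A sequence is weak Cauchy if every continuous linear functional converges along it. -/
def IsWeakCauchySeq (x : ℕ → E) : Prop :=
  ∀ u : E →L[ℝ] ℝ, ∃ l : ℝ, Tendsto (fun n => u (x n)) atTop (𝓝 l)

/-- `x` is an `ℓ¹`-sequence: it is bounded and equivalent to the `ℓ¹`-basis. -/
def IsL1Seq (x : ℕ → E) : Prop :=
  IsBoundedSeq x ∧ ∃ ρ : Seminorm ℝ E, Continuous ρ ∧ ∃ δ : ℝ, 0 < δ ∧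
    ∀ (n : ℕ) (c : ℕ → ℝ),
      δ * ∑ i ∈ Finset.range n, |c i| ≤ ρ (∑ i ∈ Finset.range n, c i • x i)

/-- `A` is Rosenthal: every bounded sequence in `A` has a weak Cauchy subsequence. -/
def IsRosenthalSet (A : Set E) : Prop :=
  ∀ x : ℕ → E, (∀ n, x n ∈ A) → IsBoundedSeq x →
    ∃ k : ℕ → ℕ, StrictMono k ∧ IsWeakCauchySeq (x ∘ k)

end

section

variable (E : Type*) [AddCommGroup E] [Module ℝ E] [TopologicalSpace E]

/-- The property `(Ros)`: every bounded sequence in `E` has a weak Cauchy subsequence. -/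
def PropRos : Prop :=
  ∀ x : ℕ → E, IsBoundedSeq x → ∃ k : ℕ → ℕ, StrictMono k ∧ IsWeakCauchySeq (x ∘ k)

/-- The property `(mT)`: every bounded subset of `E` is Mackey tame. -/
def PropMT : Prop :=
  ∀ B : Set E, Bornology.IsVonNBounded ℝ B → IsMackeyTameSet B

/-- The property `(T)`: every bounded subset of `E` is tame. -/
def PropT : Prop :=
  ∀ B : Set E, Bornology.IsVonNBounded ℝ B → IsTameSet B

/-- The property `(R₁)`: `E` has no bounded sequence equivalent to the `ℓ¹`-basis. -/
def PropR1 : Prop :=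
  ¬ ∃ x : ℕ → E, IsL1Seq x

/-- The property `(R̄₁)`: the Banach space `ℓ¹` has no linear topological embedding
into `E`. -/
def PropR1bar : Prop :=
  ¬ ∃ T : lp (fun _ : ℕ => ℝ) 1 →L[ℝ] E, IsEmbedding T

/-- All bounded subsets of `E` are metrizable (in the subspace topology). -/
def HasMetrizableBoundedSets : Prop :=
  ∀ B : Set E, Bornology.IsVonNBounded ℝ B → TopologicalSpace.MetrizableSpace B

end

end TameLCS

end

/-!
Everything follows from the dichotomy: a bounded sequence has a weak Cauchy subsequence or an
`ℓ¹`-subsequence. Indeed a Rosenthal set is Mackey tame, because an independent sequence on a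
weak-star compact set `K` has no weak Cauchy subsequence: by compactness some functional in `K`
oscillates along any given subsequence (`IsRosenthalSet.isMackeyTameSet`). And a tame set contains
no `ℓ¹`-sequence, because by Hahn–Banach such a sequence is independent over the polar of the
seminorm that witnesses it, which is equicontinuous and weak-star compact
(`IsTameSet.not_isL1Seq`).

The dichotomy itself is first proved for a single seminorm `ρ`. Rosenthal's combinatorial theorem
(`exists_independent_of_pairsDivergeOn`) says that pairs of sets, here `{φ | φ (x n) < a}` and
`{φ | b < φ (x n)}` in the polar of `ρ`, have a subsequence that converges or one that is
independent. It is proved by splitting: if no subsequence converges on any of finitely many sets,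
then some pair cuts each of them into two parts on which, along a subsequence, the same is true
(`exists_split`). Independence gives the lower `ℓ¹`-estimate for `ρ`
(`le_seminorm_sum_of_independent`).

To pass to the locally convex space, metrizability is applied to the absolutely convex hull of
the sequence: countably many continuous seminorms `ρ m` describe the neighbourhoods of zero in it
(`exists_seq_seminorm_of_metrizable`). If none of them gives an `ℓ¹`-subsequence, a diagonal
subsequence converges at every functional dominated by some `ρ m`, and every continuous functional
is, uniformly on the sequence, a limit of multiples of such functionals
(`exists_dual_near_of_le`), so the diagonal subsequence is weak Cauchy.
-/

namespace TameLCS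

/-! ### Rosenthal's combinatorial dichotomy for sequences of pairs of sets -/

section

variable {K : Type*}

/-- For a sequence of pairs of sets `S false n`, `S true n`, indexed by `n`: the pairs with
`n ∈ N` converge on `X` if no point of `X` lies both in infinitely many of the `S false n`
and in infinitely many of the `S true n`. -/
def PairsConvergeOn (S : Bool → ℕ → Set K) (N : Set ℕ) (X : Set K) : Prop :=
  ∀ t ∈ X, ∃ s, {n ∈ N | t ∈ S s n}.Finite

/-- No infinite subsequence of the pairs with `n ∈ M` converges on `X`. -/
def PairsDivergeOn (S : Bool → ℕ → Set K) (M : Set ℕ) (X : Set K) : Prop :=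
  ∀ N ⊆ M, N.Infinite → ¬ PairsConvergeOn S N X

theorem PairsConvergeOn.of_diff_finite {S : Bool → ℕ → Set K} {N N' : Set ℕ} {X : Set K}
    (h : PairsConvergeOn S N X) (hN : (N' \ N).Finite) : PairsConvergeOn S N' X := by
  intro t ht
  obtain ⟨s, hs⟩ := h t ht
  refine ⟨s, (hs.union hN).subset fun n hn => ?_⟩
  by_cases hnN : n ∈ N
  · exact Or.inl ⟨hnN, hn.2⟩
  · exact Or.inr ⟨hn.1, hnN⟩

theorem PairsDivergeOn.mono {S : Bool → ℕ → Set K} {M M' : Set ℕ} {X : Set K}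
    (h : PairsDivergeOn S M X) (hM : M' ⊆ M) : PairsDivergeOn S M' X :=
  fun N hN => h N (hN.trans hM)

theorem PairsDivergeOn.nonempty {S : Bool → ℕ → Set K} {M : Set ℕ} {X : Set K}
    (h : PairsDivergeOn S M X) (hM : M.Infinite) : X.Nonempty := by
  by_contra hX
  rw [Set.not_nonempty_iff_eq_empty] at hX
  exact h M subset_rfl hM (by simp [PairsConvergeOn, hX])

/-- Diagonal argument: countably many properties of infinite sets of integers, each insensitive
to finite changes and attainable inside every infinite set, can be attained simultaneously. -/
theorem exists_infinite_forall_of_diagonal {Q : ℕ → Set ℕ → Prop}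
    (hmono : ∀ i N N', Q i N → (N' \ N).Finite → Q i N') {M₀ : Set ℕ} (hM₀ : M₀.Infinite)
    (h : ∀ i, ∀ M ⊆ M₀, M.Infinite → ∃ N ⊆ M, N.Infinite ∧ Q i N) :
    ∃ N ⊆ M₀, N.Infinite ∧ ∀ i, Q i N := by
  choose! g hgsub hginf hgQ using h
  let V : ℕ → Set ℕ := fun n => Nat.rec M₀ (fun i M => g i M) n
  have hVs : ∀ i, V (i + 1) = g i (V i) := fun i => rfl
  have hV : ∀ i, V i ⊆ M₀ ∧ (V i).Infinite := by
    intro i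
    induction i with
    | zero => exact ⟨subset_rfl, hM₀⟩
    | succ i ih =>
      rw [hVs]
      exact ⟨(hgsub i _ ih.1 ih.2).trans ih.1, hginf i _ ih.1 ih.2⟩
  have hanti : Antitone V := antitone_nat_of_succ_le fun i => hgsub i _ (hV i).1 (hV i).2
  obtain ⟨k, hk, hkV⟩ := extraction_forall_of_frequently
    (fun n => Nat.frequently_atTop_iff_infinite.2 (hV n).2 : ∀ n, ∃ᶠ k in atTop, k ∈ V n)
  refine ⟨Set.range k, ?_, Set.infinite_range_of_injective hk.injective, fun i => ?_⟩
  · rintro _ ⟨n, rfl⟩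
    exact (hV n).1 (hkV n)
  · refine hmono i (V (i + 1)) _ (hgQ i _ (hV i).1 (hV i).2) ?_
    refine ((Set.finite_Iio (i + 1)).image k).subset ?_
    rintro _ ⟨⟨n, rfl⟩, hn⟩
    refine ⟨n, ?_, rfl⟩
    by_contra hlt
    exact hn (hanti (not_lt.1 hlt) (hkV n))

/-- If the pairs diverge on each of finitely many sets, then one of the pairs splits all these
sets into parts on which a further subsequence still diverges. Otherwise a diagonal sequence
would converge on one part cut out by each of its terms; infinitely many of these parts are
`X ∩ S s m` with the same `X` and `s`, and the corresponding subsequence converges on `X`. -/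
theorem exists_split {S : Bool → ℕ → Set K} {𝒳 : Set (Set K)} (h𝒳 : 𝒳.Finite) {M : Set ℕ}
    (hM : M.Infinite) (h : ∀ X ∈ 𝒳, PairsDivergeOn S M X) :
    ∃ m ∈ M, ∃ M' ⊆ M, M'.Infinite ∧ ∀ X ∈ 𝒳, ∀ s, PairsDivergeOn S M' (X ∩ S s m) := by
  by_contra hcon
  push Not at hcon
  obtain ⟨N, hNM, hN, hQ⟩ := exists_infinite_forall_of_diagonal
    (Q := fun m N => m ∈ M → ∃ X ∈ 𝒳, ∃ s, PairsConvergeOn S N (X ∩ S s m))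
    (fun i N N' hQ hfin hi => by
      obtain ⟨X, hX, s, hs⟩ := hQ hi
      exact ⟨X, hX, s, hs.of_diff_finite hfin⟩) hM
    (fun m M' hM' hinf => by
      by_cases hm : m ∈ M
      · obtain ⟨X, hX, s, hs⟩ := hcon m hm M' hM' hinf
        simp only [PairsDivergeOn, not_forall, not_not] at hs
        obtain ⟨N, hN, hNinf, hc⟩ := hs
        exact ⟨N, hN, hNinf, fun _ => ⟨X, hX, s, hc⟩⟩
      · exact ⟨M', subset_rfl, hinf, fun hm' => absurd hm' hm⟩)
  choose X hX s hs using fun m : N => hQ m (hNM m.2)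
  have := hN.to_subtype
  have := h𝒳.to_subtype
  obtain ⟨⟨X₀, s₀⟩, hfib⟩ := Finite.exists_infinite_fiber
    (fun m : N => ((⟨X m, hX m⟩ : 𝒳), s m))
  set I : Set N := (fun m : N => ((⟨X m, hX m⟩ : 𝒳), s m)) ⁻¹' {(X₀, s₀)} with hI
  have hIinf : (Subtype.val '' I).Infinite :=
    (Set.infinite_coe_iff.1 hfib).image Subtype.val_injective.injOn
  have hIN : Subtype.val '' I ⊆ N := by
    rintro _ ⟨m, -, rfl⟩
    exact m.2
  refine h X₀ X₀.2 _ (hIN.trans hNM) hIinf fun t ht => ?_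
  by_cases hemp : {n ∈ Subtype.val '' I | t ∈ S s₀ n} = ∅
  · exact ⟨s₀, hemp ▸ Set.finite_empty⟩
  · obtain ⟨_, ⟨m, hm, rfl⟩, htm⟩ := Set.nonempty_iff_ne_empty.2 hemp
    simp only [hI, Set.mem_preimage, Set.mem_singleton_iff, Prod.mk.injEq] at hm
    obtain ⟨s', hs'⟩ := hs m t ⟨by rw [← hm.1] at ht; exact ht, by rw [hm.2]; exact htm⟩
    exact ⟨s', hs'.subset fun n hn => ⟨hIN hn.1, hn.2⟩⟩

/-- Rosenthal's theorem: a sequence of pairs without convergent subsequence has an independent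
subsequence. -/
theorem exists_independent_of_pairsDivergeOn {S : Bool → ℕ → Set K} {M : Set ℕ}
    (hM : M.Infinite) (h : PairsDivergeOn S M Set.univ) :
    ∃ k : ℕ → ℕ, StrictMono k ∧
      ∀ (σ : ℕ → Bool) (n : ℕ), (⋂ i < n, S (σ i) (k i)).Nonempty := by
  -- the states of the recursion: the sets cut out so far and the surviving indices
  let St := {p : Set (Set K) × Set ℕ //
    p.1.Finite ∧ p.2.Infinite ∧ ∀ X ∈ p.1, PairsDivergeOn S p.2 X}
  have step : ∀ p : St, ∃ m ∈ p.1.2, ∃ q : St, q.1.2 ⊆ {n ∈ p.1.2 | m < n} ∧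
      ∀ X ∈ p.1.1, ∀ s, X ∩ S s m ∈ q.1.1 := by
    rintro ⟨⟨𝒳, M⟩, h𝒳, hM, hdiv⟩
    obtain ⟨m, hm, M', hM', hinf, hM'div⟩ := exists_split h𝒳 hM hdiv
    refine ⟨m, hm, ⟨⟨Set.image2 (fun X s => X ∩ S s m) 𝒳 Set.univ, M' \ Set.Iic m⟩,
      h𝒳.image2 _ Set.finite_univ, hinf.sdiff (Set.finite_Iic m), ?_⟩, ?_, ?_⟩
    · rintro _ ⟨X, hX, s, -, rfl⟩
      exact (hM'div X hX s).mono Set.sdiff_subset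
    · exact fun n hn => ⟨hM' hn.1, not_le.1 hn.2⟩
    · exact fun X hX s => ⟨X, hX, s, trivial, rfl⟩
  choose m hm q hq hqX using step
  let V : ℕ → St := fun n => q^[n] ⟨({Set.univ}, M), Set.finite_singleton _, hM, by simpa using h⟩
  have hVs : ∀ n, V (n + 1) = q (V n) := fun n => Function.iterate_succ_apply' _ _ _
  refine ⟨fun n => m (V n), strictMono_nat_of_lt_succ fun n => ?_, fun σ n => ?_⟩
  · have := hm (V (n + 1))
    rw [hVs] at this ⊢
    exact (hq _ this).2
  · have hmem : ∀ n, (⋂ i < n, S (σ i) (m (V i))) ∈ (V n).1.1 := by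
      intro n
      induction n with
      | zero => simp [V]
      | succ n ih =>
        rw [hVs, Set.biInter_lt_succ]
        exact hqX _ _ ih _
    exact ((V n).2.2.2 _ (hmem n)).nonempty (V n).2.2.1

end

/-! ### Linear functionals dominated by a seminorm -/

/-- Hahn–Banach along a linear map: a functional on the source dominated by a seminorm of the
target factors through a functional on the target dominated by the same seminorm. -/
theorem exists_dual_of_le_seminorm {F E : Type*} [AddCommGroup F] [Module ℝ F]
    [AddCommGroup E] [Module ℝ E] (T : F →ₗ[ℝ] E) (g : F →ₗ[ℝ] ℝ) (p : Seminorm ℝ E)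
    (h : ∀ c, g c ≤ p (T c)) :
    ∃ φ : E →ₗ[ℝ] ℝ, (∀ c, φ (T c) = g c) ∧ ∀ x, |φ x| ≤ p x := by
  have hker : g ∈ T.dualMap.range := by
    rw [LinearMap.range_dualMap_eq_dualAnnihilator_ker, Submodule.mem_dualAnnihilator]
    intro c hc
    rw [LinearMap.mem_ker] at hc
    have := Seminorm.abs_le_of_le (p := p.comp T) (f := g) h c
    rw [Seminorm.comp_apply, hc, map_zero] at this
    exact abs_nonpos_iff.1 this
  obtain ⟨f, rfl⟩ := hker
  obtain ⟨φ, hφ, hle⟩ := Module.Dual.exists_extension_of_le_seminorm_real T.range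
    (f.domRestrict T.range) (p := p) (by
      rintro ⟨_, c, rfl⟩
      exact h c)
  exact ⟨φ, fun c => hφ ⟨T c, c, rfl⟩, hle⟩

section

variable {E : Type*} [AddCommGroup E] [Module ℝ E]

/-- Independence over the polar of `ρ` gives the lower `ℓ¹`-estimate: test `∑ cᵢ xᵢ` against
two functionals whose values on the `xᵢ` are separated according to the sign of `cᵢ`, once in
either direction. -/
theorem le_seminorm_sum_of_independent {ρ : Seminorm ℝ E} {x : ℕ → E} {a b : ℝ}
    (h : ∀ (σ : ℕ → Bool) (n : ℕ), ∃ φ : E →ₗ[ℝ] ℝ, (∀ y, |φ y| ≤ ρ y) ∧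
      ∀ i < n, if σ i then b < φ (x i) else φ (x i) < a) (n : ℕ) (c : ℕ → ℝ) :
    (b - a) / 2 * ∑ i ∈ Finset.range n, |c i| ≤ ρ (∑ i ∈ Finset.range n, c i • x i) := by
  obtain ⟨φ, hφ, hφx⟩ := h (fun i => decide (0 ≤ c i)) n
  obtain ⟨ψ, hψ, hψx⟩ := h (fun i => decide (c i < 0)) n
  set y := ∑ i ∈ Finset.range n, c i • x i with hy
  have key : (b - a) * ∑ i ∈ Finset.range n, |c i| ≤ φ y - ψ y := by
    simp only [hy, map_sum, map_smul, smul_eq_mul, ← Finset.sum_sub_distrib, Finset.mul_sum]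
    refine Finset.sum_le_sum fun i hi => ?_
    have h1 := hφx i (Finset.mem_range.1 hi)
    have h2 := hψx i (Finset.mem_range.1 hi)
    rcases le_or_gt 0 (c i) with hc | hc
    · simp only [hc, decide_true, if_true, not_lt.2 hc, decide_false, Bool.false_eq_true,
        if_false] at h1 h2
      rw [abs_of_nonneg hc]
      nlinarith
    · simp only [hc, decide_true, if_true, not_le.2 hc, decide_false, Bool.false_eq_true,
        if_false] at h1 h2
      rw [abs_of_neg hc]
      nlinarith
  have h1 := (abs_le.1 (hφ y)).2
  have h2 := (abs_le.1 (hψ y)).1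
  linarith

/-- Rosenthal's dichotomy for one seminorm: if no subsequence of `x` satisfies a lower
`ℓ¹`-estimate for `ρ`, then for every pair `a < b` there is, inside every infinite set of
indices, a subsequence that no functional dominated by `ρ` makes oscillate between `a` and `b`. -/
theorem exists_pairsConvergeOn_of_no_l1 {ρ : Seminorm ℝ E} {x : ℕ → E}
    (h : ¬ ∃ k : ℕ → ℕ, StrictMono k ∧ ∃ δ : ℝ, 0 < δ ∧ ∀ (n : ℕ) (c : ℕ → ℝ),
      δ * ∑ i ∈ Finset.range n, |c i| ≤ ρ (∑ i ∈ Finset.range n, c i • x (k i)))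
    {a b : ℝ} (hab : a < b) {M : Set ℕ} (hM : M.Infinite) :
    ∃ N ⊆ M, N.Infinite ∧
      PairsConvergeOn (K := {φ : E →ₗ[ℝ] ℝ // ∀ y, |φ y| ≤ ρ y})
        (fun s n => {φ | if s then b < φ.1 (x n) else φ.1 (x n) < a}) N Set.univ := by
  by_contra hcon
  push Not at hcon
  obtain ⟨k, hk, hne⟩ := exists_independent_of_pairsDivergeOn hM hcon
  refine h ⟨k, hk, (b - a) / 2, by linarith, le_seminorm_sum_of_independent fun σ n => ?_⟩
  obtain ⟨φ, hφ⟩ := hne σ n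
  refine ⟨φ.1, φ.2, fun i hi => ?_⟩
  simp only [Set.mem_iInter] at hφ
  exact hφ i hi

/-! ### Finite combinations of a bounded sequence -/

/-- The `ℓ¹`-norm on finitely supported sequences. -/
noncomputable def l1Seminorm : Seminorm ℝ (ℕ →₀ ℝ) :=
  Seminorm.of (fun c => c.sum fun _ a => |a|)
    (fun c d => by
      classical
      rw [Finsupp.sum_of_support_subset (c + d) Finsupp.support_add _ (by simp),
        Finsupp.sum_of_support_subset c (Finset.subset_union_left (s₂ := d.support)) _ (by simp),
        Finsupp.sum_of_support_subset d (Finset.subset_union_right (s₁ := c.support)) _ (by simp),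
        ← Finset.sum_add_distrib]
      exact Finset.sum_le_sum fun i _ => abs_add_le _ _)
    (fun r c => by
      rw [Finsupp.sum_smul_index' (by simp), Finsupp.sum, Finsupp.sum, Finset.mul_sum]
      simp [abs_mul])

theorem l1Seminorm_apply (c : ℕ →₀ ℝ) : l1Seminorm c = ∑ i ∈ c.support, |c i| := rfl

theorem l1Seminorm_single (i : ℕ) (r : ℝ) : l1Seminorm (Finsupp.single i r) = |r| := by
  change (Finsupp.single i r).sum _ = _
  simp

theorem eq_zero_of_l1Seminorm_le {c : ℕ →₀ ℝ} (h : l1Seminorm c ≤ 0) : c = 0 := by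
  ext i
  by_contra hi
  have : |c i| ≤ l1Seminorm c := by
    rw [l1Seminorm_apply]
    exact Finset.single_le_sum (f := fun i => |c i|) (fun _ _ => abs_nonneg _)
      (Finsupp.mem_support_iff.2 hi)
  exact hi (abs_nonpos_iff.1 (this.trans h))

theorem seminorm_linearCombination_le (ρ : Seminorm ℝ E) {x : ℕ → E} {R : ℝ}
    (hR : ∀ n, ρ (x n) ≤ R) (c : ℕ →₀ ℝ) :
    ρ (Finsupp.linearCombination ℝ x c) ≤ R * l1Seminorm c := by
  rw [Finsupp.linearCombination_apply, Finsupp.sum, l1Seminorm_apply, Finset.mul_sum]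
  refine (Finset.le_sum_of_subadditive ρ (map_zero ρ).le (map_add_le_add ρ) _ _).trans
    (Finset.sum_le_sum fun i _ => ?_)
  rw [map_smul_eq_mul, Real.norm_eq_abs, mul_comm]
  exact mul_le_mul_of_nonneg_right (hR i) (abs_nonneg _)

/-- A functional that is at most `ε` on the part of the absolutely convex hull of the `xₙ` where
`ρ < 1` differs by at most `ε` on the `xₙ` from a functional dominated by `2 * ε * ρ`: the
functional `c ↦ u (∑ cᵢ xᵢ)` is dominated by `ε ‖c‖₁ + 2 ε ρ (∑ cᵢ xᵢ)`, and Hahn–Banach on the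
product of the two spaces splits it accordingly. -/
theorem exists_dual_near_of_le (u : E →ₗ[ℝ] ℝ) (ρ : Seminorm ℝ E) (x : ℕ → E) {ε : ℝ}
    (hε : 0 ≤ ε)
    (h : ∀ c : ℕ →₀ ℝ, l1Seminorm c ≤ 1 → ρ (Finsupp.linearCombination ℝ x c) < 1 →
      u (Finsupp.linearCombination ℝ x c) ≤ ε) :
    ∃ ψ : E →ₗ[ℝ] ℝ, (∀ y, |ψ y| ≤ 2 * ε * ρ y) ∧ ∀ n, |u (x n) - ψ (x n)| ≤ ε := by
  set T := Finsupp.linearCombination ℝ x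
  let N : Seminorm ℝ ((ℕ →₀ ℝ) × E) :=
    ε.toNNReal • (l1Seminorm.comp (LinearMap.fst ℝ (ℕ →₀ ℝ) E) +
      (2 : NNReal) • ρ.comp (LinearMap.snd ℝ (ℕ →₀ ℝ) E))
  have hN : ∀ c y, N (c, y) = ε * (l1Seminorm c + 2 * ρ y) := by
    intro c y
    simp [N, NNReal.smul_def, hε, mul_add]
  obtain ⟨φ, hφ, hφN⟩ := exists_dual_of_le_seminorm (LinearMap.prod LinearMap.id T) (u ∘ₗ T) N (by
    intro c
    change u (T c) ≤ N (c, T c)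
    rw [hN]
    set s := l1Seminorm c + 2 * ρ (T c)
    have h1 : 0 ≤ l1Seminorm c := apply_nonneg _ _
    have h2 : 0 ≤ ρ (T c) := apply_nonneg _ _
    rcases (show 0 ≤ s by positivity).eq_or_lt with hs | hs
    · have : c = 0 := eq_zero_of_l1Seminorm_le (by grind)
      simp [this, ← hs]
    · have := h (s⁻¹ • c)
        (by
          rw [map_smul_eq_mul, Real.norm_eq_abs, abs_of_pos (inv_pos.2 hs), inv_mul_le_iff₀ hs]
          grind)
        (by
          rw [map_smul, map_smul_eq_mul, Real.norm_eq_abs, abs_of_pos (inv_pos.2 hs),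
            inv_mul_lt_iff₀ hs]
          grind)
      rwa [map_smul, map_smul, smul_eq_mul, inv_mul_le_iff₀ hs, mul_comm] at this)
  refine ⟨φ ∘ₗ LinearMap.inr ℝ _ _, fun y => ?_, fun n => ?_⟩
  · refine (hφN (0, y)).trans_eq ?_
    rw [hN, map_zero]
    ring
  · have h1 : φ (Finsupp.single n 1, x n) = u (x n) := by
      simpa [T] using hφ (Finsupp.single n 1)
    have h2 := hφN (Finsupp.single n 1, 0)
    rw [hN, map_zero, l1Seminorm_single] at h2
    have h3 : u (x n) - φ (0, x n) = φ (Finsupp.single n 1, 0) := by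
      rw [← h1, ← map_sub]
      simp
    simpa [h3] using h2

end

/-! ### Continuous seminorms and bounded sets -/

section

variable {E : Type*} [AddCommGroup E] [Module ℝ E] [TopologicalSpace E]

theorem continuous_of_abs_le_seminorm [IsTopologicalAddGroup E] {φ : E →ₗ[ℝ] ℝ} {ρ : Seminorm ℝ E}
    (hρ : Continuous ρ) (h : ∀ y, |φ y| ≤ ρ y) : Continuous φ := by
  refine continuous_of_continuousAt_zero φ ?_
  rw [ContinuousAt, map_zero]
  exact squeeze_zero_norm h (map_zero ρ ▸ hρ.tendsto 0)

theorem bddAbove_seminorm_of_isVonNBounded {B : Set E} (hB : Bornology.IsVonNBounded ℝ B)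
    {ρ : Seminorm ℝ E} (hρ : Continuous ρ) : ∃ R, ∀ x ∈ B, ρ x ≤ R := by
  have hmem : ρ.ball 0 1 ∈ 𝓝 (0 : E) := ρ.ball_mem_nhds hρ one_pos
  obtain ⟨r, hr, hsub⟩ := (hB hmem).exists_pos
  refine ⟨r, fun x hx => ?_⟩
  obtain ⟨y, hy, rfl⟩ := hsub r (by simp [abs_of_pos hr]) hx
  rw [Seminorm.mem_ball_zero] at hy
  simp only [map_smul_eq_mul, Real.norm_eq_abs, abs_of_pos hr]
  nlinarith

variable [IsTopologicalAddGroup E] [ContinuousSMul ℝ E] [LocallyConvexSpace ℝ E]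

theorem exists_continuous_seminorm_ball_subset {U : Set E} (hU : U ∈ 𝓝 (0 : E)) :
    ∃ ρ : Seminorm ℝ E, Continuous ρ ∧ ∀ x, ρ x < 1 → x ∈ U := by
  obtain ⟨s, hs, hsU⟩ := (nhds_hasBasis_absConvex_open ℝ E).mem_iff.1 hU
  let V : AbsConvexOpenSets ℝ E := ⟨s, hs⟩
  refine ⟨gaugeSeminormFamily ℝ E V, with_gaugeSeminormFamily.continuous_seminorm V,
    fun x hx => hsU ?_⟩
  have hxV : x ∈ (gaugeSeminormFamily ℝ E V).ball 0 1 := (Seminorm.mem_ball_zero _).2 hx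
  rw [gaugeSeminormFamily_ball] at hxV
  exact hxV

theorem isVonNBounded_of_seminorm_le {B : Set E}
    (h : ∀ ρ : Seminorm ℝ E, Continuous ρ → ∃ R, ∀ x ∈ B, ρ x ≤ R) :
    Bornology.IsVonNBounded ℝ B := by
  refine (with_gaugeSeminormFamily (𝕜 := ℝ) (E := E)).isVonNBounded_iff_seminorm_bounded.2
    fun i => ?_
  obtain ⟨R, hR⟩ := h _ (with_gaugeSeminormFamily.continuous_seminorm i)
  exact ⟨max R 0 + 1, by positivity, fun x hx => ((hR x hx).trans (le_max_left _ _)).trans_lt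
    (lt_add_one _)⟩

/-- The absolutely convex hull of a bounded sequence is bounded. -/
theorem isVonNBounded_image_l1Seminorm_le_one {x : ℕ → E} (hx : IsBoundedSeq x) :
    Bornology.IsVonNBounded ℝ (Finsupp.linearCombination ℝ x '' {c | l1Seminorm c ≤ 1}) := by
  refine isVonNBounded_of_seminorm_le fun ρ hρ => ?_
  obtain ⟨R, hR⟩ := bddAbove_seminorm_of_isVonNBounded hx hρ
  refine ⟨R, ?_⟩
  rintro _ ⟨c, hc, rfl⟩
  have hR' : ∀ n, ρ (x n) ≤ R := fun n => hR _ ⟨n, rfl⟩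
  have hR0 : 0 ≤ R := (apply_nonneg ρ _).trans (hR' 0)
  exact (seminorm_linearCombination_le ρ hR' c).trans (mul_le_of_le_one_right hR0 hc)

/-- On a metrizable set, countably many continuous seminorms determine the neighbourhoods of
zero. -/
theorem exists_seq_seminorm_of_metrizable {B : Set E} [TopologicalSpace.MetrizableSpace B]
    (h0 : (0 : E) ∈ B) :
    ∃ ρ : ℕ → Seminorm ℝ E, (∀ m, Continuous (ρ m)) ∧
      ∀ U ∈ 𝓝 (0 : E), ∃ m, ∀ x ∈ B, ρ m x < 1 → x ∈ U := by
  let _ := TopologicalSpace.metrizableSpaceMetric B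
  have : (𝓝[B] (0 : E)).IsCountablyGenerated := by
    rw [nhdsWithin_eq_map_subtype_coe h0]
    infer_instance
  obtain ⟨s, hs⟩ := (𝓝[B] (0 : E)).exists_antitone_basis
  have hV : ∀ m, ∃ ρ : Seminorm ℝ E, Continuous ρ ∧ ∀ x ∈ B, ρ x < 1 → x ∈ s m := by
    intro m
    obtain ⟨V, hV, hVs⟩ := mem_nhdsWithin_iff_exists_mem_nhds_inter.1 (hs.1.mem_of_mem trivial
      : s m ∈ 𝓝[B] (0 : E))
    obtain ⟨ρ, hρ, hρV⟩ := exists_continuous_seminorm_ball_subset hV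
    exact ⟨ρ, hρ, fun x hx hlt => hVs ⟨hρV x hlt, hx⟩⟩
  choose ρ hρ hρs using hV
  refine ⟨ρ, hρ, fun U hU => ?_⟩
  obtain ⟨m, -, hm⟩ := hs.1.mem_iff.1 (mem_nhdsWithin_of_mem_nhds hU)
  exact ⟨m, fun x hx hlt => hm (hρs m x hx hlt)⟩

end

section

variable {E : Type*} [AddCommGroup E] [Module ℝ E] [TopologicalSpace E]

/-! ### The generalized Rosenthal dichotomy -/

/-- A real sequence bounded by `R` converges along the increasing enumeration of `N` if it
crosses no rational interval infinitely often along `N`. -/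
theorem exists_tendsto_nth {f : ℕ → ℝ} {R : ℝ} (hR : ∀ n, |f n| ≤ R) {N : Set ℕ}
    (hN : N.Infinite)
    (h : ∀ a b : ℚ, a < b → {n ∈ N | f n < a}.Finite ∨ {n ∈ N | (b : ℝ) < f n}.Finite) :
    ∃ l, Tendsto (fun n => f (Nat.nth (· ∈ N) n)) atTop (𝓝 l) := by
  have key : ∀ p : ℕ → Prop, (∃ᶠ n in atTop, p (Nat.nth (· ∈ N) n)) →
      {n ∈ N | p n}.Infinite := by
    intro p hp
    refine ((Nat.frequently_atTop_iff_infinite.1 hp).image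
      (Nat.nth_injective hN).injOn).mono ?_
    rintro _ ⟨n, hn, rfl⟩
    exact ⟨Nat.nth_mem_of_infinite hN n, hn⟩
  refine tendsto_of_no_upcrossings (s := Set.range ((↑) : ℚ → ℝ)) Rat.denseRange_cast ?_
    (isBoundedUnder_of ⟨R, fun n => (abs_le.1 (hR _)).2⟩)
    (isBoundedUnder_of ⟨-R, fun n => (abs_le.1 (hR _)).1⟩)
  rintro _ ⟨a, rfl⟩ _ ⟨b, rfl⟩ hab ⟨ha, hb⟩
  rcases h a b (by exact_mod_cast hab) with hf | hf
  · exact key (fun n => f n < a) ha hf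
  · exact key (fun n => (b : ℝ) < f n) hb hf

theorem exists_weakCauchy_or_l1_subseq [IsTopologicalAddGroup E] [ContinuousSMul ℝ E]
    [LocallyConvexSpace ℝ E] (hE : HasMetrizableBoundedSets E) {x : ℕ → E}
    (hx : IsBoundedSeq x) :
    (∃ k : ℕ → ℕ, StrictMono k ∧ IsWeakCauchySeq (x ∘ k)) ∨
      ∃ k : ℕ → ℕ, StrictMono k ∧ IsL1Seq (x ∘ k) := by
  have := hE _ (isVonNBounded_image_l1Seminorm_le_one hx)
  obtain ⟨ρ, hρ, hρU⟩ := exists_seq_seminorm_of_metrizable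
    (B := Finsupp.linearCombination ℝ x '' {c | l1Seminorm c ≤ 1}) ⟨0, by simp⟩
  by_cases hl : ∃ m, ∃ k : ℕ → ℕ, StrictMono k ∧ ∃ δ : ℝ, 0 < δ ∧ ∀ (n : ℕ) (c : ℕ → ℝ),
      δ * ∑ i ∈ Finset.range n, |c i| ≤ ρ m (∑ i ∈ Finset.range n, c i • x (k i))
  · obtain ⟨m, k, hk, hδ⟩ := hl
    exact Or.inr ⟨k, hk, hx.subset (Set.range_comp_subset_range k x), ρ m, hρ m, hδ⟩
  left
  push Not at hl
  obtain ⟨e, he⟩ := exists_surjective_nat (ℕ × ℚ × ℚ)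
  obtain ⟨N, -, hN, hQ⟩ := exists_infinite_forall_of_diagonal
    (Q := fun i N => (e i).2.1 < (e i).2.2 →
      PairsConvergeOn (K := {φ : E →ₗ[ℝ] ℝ // ∀ y, |φ y| ≤ ρ (e i).1 y})
        (fun s n => {φ | if s then ((e i).2.2 : ℝ) < φ.1 (x n) else φ.1 (x n) < (e i).2.1})
        N Set.univ)
    (fun i N N' hQ hfin hlt => (hQ hlt).of_diff_finite hfin) Set.infinite_univ
    (fun i M _ hM => by
      by_cases hlt : (e i).2.1 < (e i).2.2
      · obtain ⟨N, hNM, hN, hc⟩ := exists_pairsConvergeOn_of_no_l1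
          (ρ := ρ (e i).1) (x := x) (fun ⟨k, hk, δ, hδ, h⟩ => by
            obtain ⟨n, c, hnc⟩ := hl _ k hk δ hδ
            exact absurd (h n c) (not_le.2 hnc))
          (show ((e i).2.1 : ℝ) < (e i).2.2 by exact_mod_cast hlt) hM
        exact ⟨N, hNM, hN, fun _ => hc⟩
      · exact ⟨M, subset_rfl, hM, fun h => absurd h hlt⟩)
  refine ⟨Nat.nth (· ∈ N), Nat.nth_strictMono hN, fun u => ?_⟩
  have hconv : ∀ m, ∀ φ : E →ₗ[ℝ] ℝ, (∀ y, |φ y| ≤ ρ m y) →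
      ∃ l, Tendsto (fun n => φ (x (Nat.nth (· ∈ N) n))) atTop (𝓝 l) := by
    intro m φ hφ
    obtain ⟨R, hR⟩ := bddAbove_seminorm_of_isVonNBounded hx (hρ m)
    refine exists_tendsto_nth (f := fun n => φ (x n))
      (fun n => (hφ _).trans (hR _ ⟨n, rfl⟩)) hN fun a b hab => ?_
    obtain ⟨i, hi⟩ := he (m, a, b)
    have hQi := hQ i
    rw [hi] at hQi
    obtain ⟨s, hs⟩ := hQi hab ⟨φ, hφ⟩ trivial
    cases s
    · exact Or.inl (by simpa using hs)
    · exact Or.inr (by simpa using hs)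
  -- `u` is a uniform limit on the `x n` of functionals dominated by multiples of the `ρ m`
  refine cauchySeq_tendsto_of_complete (Metric.cauchySeq_iff'.2 fun ε hε => ?_)
  obtain ⟨m, hm⟩ := hρU {y | u y < ε / 4}
    ((isOpen_Iio.preimage u.continuous).mem_nhds (by simp [hε]))
  obtain ⟨ψ, hψ, hψu⟩ := exists_dual_near_of_le u.toLinearMap (ρ m) x (ε := ε / 4)
    (by positivity) fun c hc hlt => (hm _ ⟨c, hc, rfl⟩ hlt).le
  obtain ⟨l, hlim⟩ := hconv m ((ε / 2)⁻¹ • ψ) fun y => by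
    have h2 : (0 : ℝ) < ε / 2 := by positivity
    rw [LinearMap.smul_apply, smul_eq_mul, abs_mul, abs_of_pos (inv_pos.2 h2),
      inv_mul_le_iff₀ h2]
    exact (hψ y).trans_eq (by ring)
  have hlim' : Tendsto (fun n => ψ (x (Nat.nth (· ∈ N) n))) atTop (𝓝 (ε / 2 * l)) := by
    refine (hlim.const_mul (ε / 2)).congr fun n => ?_
    rw [LinearMap.smul_apply, smul_eq_mul, mul_inv_cancel_left₀ (by positivity)]
  obtain ⟨n₀, hn₀⟩ := Metric.cauchySeq_iff'.1 hlim'.cauchySeq (ε / 4) (by positivity)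
  refine ⟨n₀, fun n hn => ?_⟩
  have h1 := hψu (Nat.nth (· ∈ N) n)
  have h2 := hψu (Nat.nth (· ∈ N) n₀)
  have h3 := hn₀ n hn
  simp only [Real.dist_eq, Function.comp_apply, abs_le, abs_lt,
    ContinuousLinearMap.coe_coe] at h1 h2 h3 ⊢
  constructor <;> linarith

/-! ### Rosenthal sets, tame sets and `ℓ¹`-sequences -/

/-- On a weak-star compact set an independent sequence has, along each of its subsequences, a
functional oscillating between the two bounds, so no subsequence is weak Cauchy. -/
theorem IsRosenthalSet.isMackeyTameSet {B : Set E} (hB : Bornology.IsVonNBounded ℝ B)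
    (h : IsRosenthalSet B) : IsMackeyTameSet B := by
  rintro K hK ⟨f, hf, a, b, hab, hind⟩
  choose y hyB hy using hf
  obtain ⟨k, hk, hkc⟩ := h y hyB (hB.subset (Set.range_subset_iff.2 hyB))
  let C : ℕ → Set (WeakDual ℝ E) := fun n =>
    {φ | φ (y (k (2 * n))) ≤ a} ∩ {φ | b ≤ φ (y (k (2 * n + 1)))}
  obtain ⟨φ, -, hφ⟩ := hK.inter_iInter_nonempty C
    (fun n => (isClosed_Iic.preimage (WeakDual.eval_continuous _)).inter
      (isClosed_Ici.preimage (WeakDual.eval_continuous _)))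
    (fun u => by
      obtain ⟨φ, hφP, hφM⟩ := hind (u.image fun n => k (2 * n)) (u.image fun n => k (2 * n + 1))
        (by
          rw [Finset.disjoint_left]
          simp only [Finset.mem_image]
          rintro _ ⟨i, -, rfl⟩ ⟨j, -, hij⟩
          have := hk.injective hij
          omega)
      refine ⟨φ, φ.2, Set.mem_iInter₂.2 fun n hn => ⟨?_, ?_⟩⟩
      · have := Set.mem_iInter₂.1 hφP _ (Finset.mem_image_of_mem _ hn)
        rw [Set.mem_ofPred_eq, ← hy] at this
        exact le_of_lt this
      · have := Set.mem_iInter₂.1 hφM _ (Finset.mem_image_of_mem _ hn)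
        rw [Set.mem_ofPred_eq, ← hy] at this
        exact le_of_lt this)
  rw [Set.mem_iInter] at hφ
  obtain ⟨l, hl⟩ := hkc (WeakDual.toStrongDual φ)
  have h1 : l ≤ a := le_of_tendsto' (hl.comp (StrictMono.tendsto_atTop
    (φ := fun n : ℕ => 2 * n) fun i j hij => by dsimp only; omega)) fun n => (hφ n).1
  have h2 : b ≤ l := ge_of_tendsto' (hl.comp (StrictMono.tendsto_atTop
    (φ := fun n : ℕ => 2 * n + 1) fun i j hij => by dsimp only; omega)) fun n => (hφ n).2
  linarith

/-- The Banach–Alaoglu theorem for the polar of a continuous seminorm. -/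
theorem isCompact_setOf_abs_le_seminorm [IsTopologicalAddGroup E] {ρ : Seminorm ℝ E}
    (hρ : Continuous ρ) : IsCompact {φ : WeakDual ℝ E | ∀ y, |φ y| ≤ ρ y} := by
  refine (DFunLike.coe_injective.isEmbedding_induced (t := Pi.topologicalSpace)).isCompact_iff.mpr
    ?_
  have hpi : IsCompact (Set.pi Set.univ fun y : E => Set.Icc (-ρ y) (ρ y)) :=
    isCompact_univ_pi fun _ => isCompact_Icc
  convert hpi.inter_right (LinearMap.isClosed_range_coe E ℝ (RingHom.id ℝ)) using 1
  ext f
  constructor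
  · rintro ⟨φ, hφ, rfl⟩
    exact ⟨fun y _ => abs_le.1 (hφ y), (WeakDual.toStrongDual φ).toLinearMap, rfl⟩
  · rintro ⟨hf, φ, rfl⟩
    have hφ : ∀ y, |φ y| ≤ ρ y := fun y => abs_le.2 (hf y trivial)
    exact ⟨StrongDual.toWeakDual ⟨φ, continuous_of_abs_le_seminorm hρ hφ⟩, hφ, rfl⟩

theorem isEquicontinuousSet_setOf_abs_le_seminorm [IsTopologicalAddGroup E] {ρ : Seminorm ℝ E}
    (hρ : Continuous ρ) : IsEquicontinuousSet {φ : WeakDual ℝ E | ∀ y, |φ y| ≤ ρ y} := by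
  intro x
  refine Metric.equicontinuousAt_of_continuity_modulus (fun y => ρ (x - y)) ?_ _
    (Eventually.of_forall fun y φ => ?_)
  · have : Continuous fun y => ρ (x - y) := hρ.comp (continuous_const.sub continuous_id)
    simpa using this.tendsto x
  · rw [Real.dist_eq, ← map_sub]
    exact φ.2 _

/-- An `ℓ¹`-sequence is independent over the polar of the seminorm that witnesses it: by
Hahn–Banach the functionals in the polar take the values `±δ` on it in every pattern. -/
theorem IsTameSet.not_isL1Seq [IsTopologicalAddGroup E] {B : Set E} (hB : IsTameSet B)
    {x : ℕ → E} (hx : ∀ n, x n ∈ B) : ¬ IsL1Seq x := by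
  rintro ⟨-, ρ, hρ, δ, hδ, hle⟩
  refine hB _ (isCompact_setOf_abs_le_seminorm hρ) (isEquicontinuousSet_setOf_abs_le_seminorm hρ)
    ⟨fun n φ => φ.1 (x n), fun n => ⟨x n, hx n, rfl⟩, -δ / 2, δ / 2, by linarith,
      fun P M hPM => ?_⟩
  let ε : ℕ → ℝ := fun i => if i ∈ P then -δ else δ
  have hε : ∀ i, |ε i| = δ := by
    intro i
    by_cases hi : i ∈ P <;> simp [ε, hi, abs_of_pos hδ]
  obtain ⟨φ, hφ, hφρ⟩ := exists_dual_of_le_seminorm (Finsupp.linearCombination ℝ x)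
    (Finsupp.linearCombination ℝ ε) ρ (fun c => by
      obtain ⟨n, hn⟩ := c.support.exists_nat_subset_range
      rw [Finsupp.linearCombination_apply, Finsupp.linearCombination_apply,
        Finsupp.sum_of_support_subset c hn _ (by simp),
        Finsupp.sum_of_support_subset c hn _ (by simp)]
      refine le_trans ?_ (hle n c)
      rw [Finset.mul_sum]
      refine Finset.sum_le_sum fun i _ => (le_abs_self _).trans_eq ?_
      rw [smul_eq_mul, abs_mul, hε, mul_comm])
  have hφx : ∀ i, φ (x i) = ε i := fun i => by
    simpa using hφ (Finsupp.single i 1)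
  refine ⟨⟨StrongDual.toWeakDual ⟨φ, continuous_of_abs_le_seminorm hρ hφρ⟩, hφρ⟩, ?_, ?_⟩
  · refine Set.mem_iInter₂.2 fun n hn => ?_
    change φ (x n) < _
    rw [hφx]
    simp only [ε, hn, if_true]
    linarith
  · refine Set.mem_iInter₂.2 fun n hn => ?_
    change _ < φ (x n)
    rw [hφx]
    simp only [ε, Finset.disjoint_right.1 hPM hn, if_false]
    linarith

theorem IsL1Seq.of_isEmbedding [IsTopologicalAddGroup E] [ContinuousSMul ℝ E]
    [LocallyConvexSpace ℝ E] (T : lp (fun _ : ℕ => ℝ) 1 →L[ℝ] E) (hT : IsEmbedding T) :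
    IsL1Seq fun n => T (lp.single 1 n 1) := by
  have := (with_gaugeSeminormFamily (𝕜 := ℝ) (E := E)).toPolynormableSpace
  constructor
  · have hb : Bornology.IsVonNBounded ℝ
        (Set.range fun n : ℕ => (lp.single 1 n 1 : lp (fun _ : ℕ => ℝ) 1)) := by
      rw [NormedSpace.isVonNBounded_iff]
      refine isBounded_iff_forall_norm_le.2 ⟨1, ?_⟩
      rintro _ ⟨n, rfl⟩
      simp [lp.norm_single]
    refine (hb.image T).subset ?_
    rintro _ ⟨n, rfl⟩
    exact ⟨_, ⟨n, rfl⟩, rfl⟩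
  · obtain ⟨ρ, hρ, hle⟩ := Seminorm.exists_le_comp_of_isInducing
      (p := normSeminorm ℝ (lp (fun _ : ℕ => ℝ) 1)) continuous_norm (f := T.toLinearMap)
      hT.isInducing
    refine ⟨ρ, hρ, 1, one_pos, fun n c => ?_⟩
    have h1 := hle (∑ i ∈ Finset.range n, lp.single 1 i (c i))
    have h2 := lp.norm_sum_single (p := 1) (E := fun _ : ℕ => ℝ) (by simp) c (Finset.range n)
    simp only [ENNReal.toReal_one, Real.rpow_one, Real.norm_eq_abs] at h2
    have h3 : ∀ i, c i • T (lp.single 1 i 1) = T (lp.single 1 i (c i)) := fun i => by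
      rw [← map_smul, ← lp.single_smul, smul_eq_mul, mul_one]
    rw [one_mul, ← h2]
    simp only [h3, ← map_sum]
    exact h1

end

end TameLCS

theorem theoremt {E : Type*} [AddCommGroup E] [Module ℝ E] [TopologicalSpace E]
    [IsTopologicalAddGroup E] [ContinuousSMul ℝ E] [LocallyConvexSpace ℝ E] [T2Space E]
    (hE : TameLCS.HasMetrizableBoundedSets E) :
    (TameLCS.PropRos E ↔ TameLCS.PropMT E) ∧
    (TameLCS.PropMT E ↔ TameLCS.PropT E) ∧
    (TameLCS.PropT E ↔ TameLCS.PropR1 E) ∧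
    (TameLCS.PropR1 E → TameLCS.PropR1bar E) ∧
    (∀ B : Set E, Bornology.IsVonNBounded ℝ B →
      (TameLCS.IsRosenthalSet B ↔ TameLCS.IsTameSet B)) ∧
    (∀ x : ℕ → E, TameLCS.IsBoundedSeq x →
      (∃ k : ℕ → ℕ, StrictMono k ∧ TameLCS.IsWeakCauchySeq (x ∘ k)) ∨
      (∃ k : ℕ → ℕ, StrictMono k ∧ TameLCS.IsL1Seq (x ∘ k))) := by
  have hdich := fun (x : ℕ → E) (hx : TameLCS.IsBoundedSeq x) =>
    TameLCS.exists_weakCauchy_or_l1_subseq hE hx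
  have hRosMT : TameLCS.PropRos E → TameLCS.PropMT E := fun h B hB =>
    TameLCS.IsRosenthalSet.isMackeyTameSet hB fun x _ hx => h x hx
  have hMTT : TameLCS.PropMT E → TameLCS.PropT E := fun h B hB K hK _ => h B hB K hK
  have hTR1 : TameLCS.PropT E → TameLCS.PropR1 E := fun h ⟨x, hx⟩ =>
    (h _ hx.1).not_isL1Seq Set.mem_range_self hx
  have hR1Ros : TameLCS.PropR1 E → TameLCS.PropRos E := fun h x hx =>
    (hdich x hx).resolve_right fun ⟨k, _, hk⟩ => h ⟨_, hk⟩
  refine ⟨⟨hRosMT, fun h => hR1Ros (hTR1 (hMTT h))⟩, ⟨hMTT, fun h => hRosMT (hR1Ros (hTR1 h))⟩,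
    ⟨hTR1, fun h => hMTT (hRosMT (hR1Ros h))⟩, ?_, ?_, hdich⟩
  · rintro h ⟨T, hT⟩
    exact h ⟨_, TameLCS.IsL1Seq.of_isEmbedding T hT⟩
  · refine fun B hB => ⟨fun h K hK _ => h.isMackeyTameSet hB K hK, fun h x hxB hx => ?_⟩
    exact (hdich x hx).resolve_right fun ⟨k, _, hk⟩ => h.not_isL1Seq (fun n => hxB (k n)) hk
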